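/- A group is called hamiltonian if it is nonabelian and all of its subgroups are normal. For a positive integer $m$ let $h(m)$ denote the number of hamiltonian groups of order $m$, and $a(m)$ the number of abelian groups of order $m$, both counted up to isomorphism. Let $n = 2^e \cdot o$, where $e \ge 0$ is an integer and $o$ is an odd positive integer. Then $$ h(n) = \begin{cases} 0, & e < 3, \\ a(o), & \text{otherwise.} \end{cases} $$ -/

import Mathlib

/-- A group is hamiltonian if it is nonabelian and all of its subgroups are normal. -/
def IsHamiltonianGroup (G : Type*) [Group G] : Prop :=
  (∃ a b : G, a * b ≠ b * a) ∧ ∀ H : Subgroup G, H.Normal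

/-- A group is abelian if its multiplication is commutative. -/
def IsAbelianGroup (G : Type*) [Group G] : Prop :=
  ∀ a b : G, a * b = b * a

/-- The group structures on the set `Fin n` that have the property `P`. Every group of order `n`
is isomorphic to one of the form `Fin n` with some group structure. -/
def GroupStr (P : (G : Type) → [Group G] → Prop) (n : ℕ) : Type :=
  {s : Group (Fin n) // @P (Fin n) s}

/-- Two group structures on `Fin n` are identified when the two groups are isomorphic.
The multiplications are given explicitly, so that the multiplication modulo `n` that `Fin n`
carries by default plays no role. -/
def GroupStr.isoSetoid (P : (G : Type) → [Group G] → Prop) (n : ℕ) : Setoid (GroupStr P n) where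
  r s t := Nonempty (@MulEquiv (Fin n) (Fin n) s.1.toMul t.1.toMul)
  iseqv :=
    { refl := fun s => ⟨@MulEquiv.refl (Fin n) s.1.toMul⟩
      symm := fun {s t} h => h.elim fun f => ⟨@MulEquiv.symm _ _ s.1.toMul t.1.toMul f⟩
      trans := fun {s t u} h k => h.elim fun f => k.elim fun g =>
        ⟨@MulEquiv.trans _ _ _ s.1.toMul t.1.toMul u.1.toMul f g⟩ }

/-- There are finitely many group structures on `Fin n`, so the cardinal below is a genuine one. -/
instance GroupStr.instFinite (P : (G : Type) → [Group G] → Prop) (n : ℕ) :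
    Finite (GroupStr P n) :=
  Finite.of_injective (fun (s : GroupStr P n) (a b : Fin n) => s.1.toMul.mul a b)
    (fun s t h => Subtype.ext (Group.ext (by
      funext a b
      exact congrFun (congrFun h a) b)))

/-- The number of isomorphism classes of groups of order `n` that have the property `P`. -/
noncomputable def numGroups (P : (G : Type) → [Group G] → Prop) (n : ℕ) : ℕ :=
  Nat.card (Quotient (GroupStr.isoSetoid P n))

/-- `a(n)`: the number of abelian groups of order `n`, up to isomorphism. -/
noncomputable def numAbelianGroups (n : ℕ) : ℕ :=
  numGroups (fun G [Group G] => IsAbelianGroup G) n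

/-- `h(n)`: the number of hamiltonian groups of order `n`, up to isomorphism. -/
noncomputable def numHamiltonianGroups (n : ℕ) : ℕ :=
  numGroups (fun G [Group G] => IsHamiltonianGroup G) n

/-!
The proof rests on Dedekind's classification: a finite hamiltonian group of order `2 ^ e * o`, with
`o` odd, is `Q₈ × C₂ ^ (e - 3) × A`, where `Q₈` is the quaternion group of order eight and `A` is
abelian of order `o`. In particular `3 ≤ e`. Conversely every such product is hamiltonian
(`isHamiltonianGroup_quaternion_prod`), because conjugation by an element either fixes a given `g`
or cubes its quaternion component, and in the latter case the conjugate is the power `g ^ m` with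
`m ≡ 3` modulo 4 and `m ≡ 1` modulo `o`. As `A` is determined by the product up to isomorphism
(`nonempty_mulEquiv_of_quaternion_prod`), isomorphism classes of hamiltonian groups of order
`2 ^ e * o` with `3 ≤ e` correspond to those of abelian groups of order `o`.

For the classification let all subgroups of the finite group `G` be normal. Then the commutator of
`x` and `y` lies in `⟨x⟩ ∩ ⟨y⟩`, so it is central in `⟨x, y⟩`. If `G` is not abelian, a noncommuting
pair with `orderOf x + orderOf y` minimal satisfies `x ^ 2 = y ^ 2 = ⁅x, y⁆`, of order two
(`exists_sq_eq_commutator`): minimality forces both orders to be powers of the prime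
`p = orderOf ⁅x, y⁆`, and unless `p = 2` and both orders are 4, the one of smaller order, say `y`,
can be multiplied by a power of `x` to lower its order further. Consequently `G` is abelian when its
order is odd. In general `G` is the product of its Sylow 2-subgroup and a normal complement, which
is abelian.

In a 2-group, `x` and `y` generate a copy of `Q₈`. Conjugation by any element acts on it as an inner
automorphism (`exists_mul_quaternionHom_commute`), and its centralizer has exponent two
(`sq_eq_one_of_commute`). A subgroup that is maximal among those avoiding `x ^ 2` is therefore an
elementary abelian direct complement of `Q₈` (`exists_quaternion_prod_mulEquiv`).
-/

open scoped commutatorElement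

/-! ### Commutators in groups all of whose subgroups are normal -/

section Commutators

variable {G : Type*} [Group G]

theorem commutator_mem_zpowers_left (hD : ∀ H : Subgroup G, H.Normal) (x y : G) :
    ⁅x, y⁆ ∈ Subgroup.zpowers x := by
  have h := (hD (Subgroup.zpowers x)).conj_mem x⁻¹ (inv_mem (Subgroup.mem_zpowers x)) y
  have h2 := mul_mem (Subgroup.mem_zpowers x) h
  simpa [commutatorElement_def, mul_assoc] using h2

theorem commutator_mem_zpowers_right (hD : ∀ H : Subgroup G, H.Normal) (x y : G) :
    ⁅x, y⁆ ∈ Subgroup.zpowers y := by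
  rw [← commutatorElement_inv]
  exact inv_mem (commutator_mem_zpowers_left hD y x)

theorem commute_of_mem_zpowers {x g : G} (h : g ∈ Subgroup.zpowers x) : Commute x g := by
  obtain ⟨k, rfl⟩ := h
  exact (Commute.refl x).zpow_right k

theorem commutator_pow_left {w y : G} (h : Commute w ⁅w, y⁆) (n : ℕ) :
    ⁅w ^ n, y⁆ = ⁅w, y⁆ ^ n := by
  have h1 : ⁅w, y⁆ = w * (y * w⁻¹ * y⁻¹) := by simp [commutatorElement_def, mul_assoc]
  have h2 : Commute w (y * w⁻¹ * y⁻¹) := by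
    have : y * w⁻¹ * y⁻¹ = w⁻¹ * ⁅w, y⁆ := by simp [commutatorElement_def, mul_assoc]
    rw [this]
    exact (Commute.refl w).inv_right.mul_right h
  rw [h1, h2.mul_pow, conj_pow]
  simp [commutatorElement_def, mul_assoc]

/-- The power formula for the product of two elements that commute with their commutator. -/
theorem mul_pow_of_commute_commutator {w y : G} (hw : Commute w ⁅w, y⁆) (hy : Commute y ⁅w, y⁆)
    (n : ℕ) : (y * w) ^ n = y ^ n * w ^ n * ⁅w, y⁆ ^ n.choose 2 := by
  induction n with
  | zero => simp
  | succ n ih =>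
    have hwn : w ^ n * y = y * w ^ n * ⁅w, y⁆ ^ n := by
      have h1 : ⁅w, y⁆ ^ n * (y * w ^ n) = w ^ n * y := by
        rw [← commutator_pow_left hw]; simp [commutatorElement_def]
      rw [← h1]
      exact ((hy.symm.pow_left n).mul_right ((hw.symm.pow_left n).pow_right n)).eq
    have hcy := (hy.pow_right (n.choose 2)).eq
    have hcw := (hw.pow_right (n.choose 2)).eq
    have hcw' := (hw.pow_right n).eq
    calc (y * w) ^ (n + 1) = y ^ n * w ^ n * ⁅w, y⁆ ^ n.choose 2 * (y * w) := by rw [pow_succ, ih]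
      _ = y ^ n * (w ^ n * y) * w * ⁅w, y⁆ ^ n.choose 2 := by
        simp only [mul_assoc, hcw]
        rw [← mul_assoc _ y w, ← hcy, mul_assoc]
      _ = y ^ n * y * w ^ n * (⁅w, y⁆ ^ n * w) * ⁅w, y⁆ ^ n.choose 2 := by
        rw [hwn]; simp only [mul_assoc]
      _ = y ^ (n + 1) * w ^ (n + 1) * ⁅w, y⁆ ^ (n + 1).choose 2 := by
        rw [← hcw', Nat.choose_succ_succ' n 1, Nat.choose_one_right, pow_succ, pow_succ, pow_add]
        simp only [mul_assoc]

end Commutators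

/-- In the power formula the exponent of the commutator vanishes modulo `p` unless `p ^ n = 2`. -/
theorem eq_two_of_not_dvd_choose_two {p n : ℕ} (hp : p.Prime)
    (h : ¬ p ∣ (p ^ n).choose 2) : p = 2 ∧ n = 1 := by
  have h2 : 2 * (p ^ n).choose 2 = p ^ n * (p ^ n - 1) := by
    rw [Nat.choose_two_right, Nat.mul_div_cancel' (Nat.even_mul_pred_self _).two_dvd]
  have hn : n ≠ 0 := by
    rintro rfl
    simp at h
  have hp2 : p = 2 := by
    by_contra hne
    have hc : Nat.Coprime p 2 := (Nat.coprime_primes hp Nat.prime_two).2 hne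
    exact h (hc.dvd_of_dvd_mul_left (h2 ▸ (dvd_pow_self p hn).mul_right _))
  subst hp2
  refine ⟨rfl, ?_⟩
  by_contra hne
  apply h
  have h4 : 2 * 2 ∣ 2 * (2 ^ n).choose 2 := by
    rw [h2]
    exact Dvd.dvd.mul_right (pow_dvd_pow 2 (by omega : 2 ≤ n)) _
  exact Nat.dvd_of_mul_dvd_mul_left two_pos h4

/-! ### A noncommuting pair of minimal total order -/

section MinimalPair

variable {G : Type*} [Group G] [Finite G]

/-- Two elements of the same order in a finite cyclic group generate the same subgroup. -/
theorem mem_zpowers_of_orderOf_eq {p : ℕ} {y c g : G} (hc : c ∈ Subgroup.zpowers y)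
    (hg : g ∈ Subgroup.zpowers y) (hoc : orderOf c = p) (hog : orderOf g = p) :
    g ∈ Subgroup.zpowers c := by
  classical
  obtain ⟨i, hi⟩ := hc
  have hp : 0 < p := hoc ▸ orderOf_pos c
  let C := Subgroup.zpowers y
  have := Fintype.ofFinite C
  let S : Finset C := {a : C | a ^ p = 1}
  let f : ℕ → C := fun k => ⟨c, hi ▸ ⟨i, rfl⟩⟩ ^ k
  have hf : Set.InjOn f (Finset.range p) := by
    intro a ha b hb hab
    have : c ^ a = c ^ b := by simpa [f] using congrArg Subtype.val hab
    exact pow_injOn_Iio_orderOf (by simpa [hoc] using ha) (by simpa [hoc] using hb) this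
  have hsub : (Finset.range p).image f ⊆ S := by
    intro a ha
    obtain ⟨k, -, rfl⟩ := Finset.mem_image.1 ha
    simp only [S, f, Finset.mem_filter, Finset.mem_univ, true_and]
    ext
    simp [pow_right_comm c k, ← hoc, pow_orderOf_eq_one]
  have heq : (Finset.range p).image f = S := by
    apply Finset.eq_of_subset_of_card_le hsub
    rw [Finset.card_image_of_injOn hf, Finset.card_range]
    exact IsCyclic.card_pow_eq_one_le hp
  have hgS : (⟨g, hg⟩ : C) ∈ S := by
    simp only [S, Finset.mem_filter, Finset.mem_univ, true_and]
    ext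
    simp [← hog, pow_orderOf_eq_one]
  rw [← heq] at hgS
  obtain ⟨k, -, hk⟩ := Finset.mem_image.1 hgS
  exact ⟨k, by simpa [f] using congrArg Subtype.val hk⟩

theorem orderOf_pow_prime_lt {x : G} {p : ℕ} (hp : p.Prime) (h : p ∣ orderOf x) :
    orderOf (x ^ p) < orderOf x := by
  rw [orderOf_pow_of_dvd hp.ne_zero h]
  exact Nat.div_lt_self (orderOf_pos x) hp.one_lt


/-- A noncommuting pair of minimal total order consists of elements of order four, whose commutator
has order two. -/
theorem orderOf_eq_four_of_minimal (hD : ∀ H : Subgroup G, H.Normal) {x y : G}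
    (hxy : ¬ Commute x y)
    (hmin : ∀ a b : G, ¬ Commute a b → orderOf x + orderOf y ≤ orderOf a + orderOf b)
    (hle : orderOf y ≤ orderOf x) :
    orderOf x = 4 ∧ orderOf y = 4 ∧ orderOf ⁅x, y⁆ = 2 := by
  have hl := commutator_mem_zpowers_left hD
  have hr := commutator_mem_zpowers_right hD
  have hc1 : ⁅x, y⁆ ≠ 1 := fun h => hxy (commutatorElement_eq_one_iff_commute.1 h)
  -- By minimality, `x ^ q` commutes with `y` for each prime divisor `q` of the order of `x`.
  have hxq : ∀ q : ℕ, q.Prime → q ∣ orderOf x → Commute (x ^ q) y := by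
    intro q hq hd
    by_contra h
    have := hmin _ _ h
    have := orderOf_pow_prime_lt hq hd
    omega
  have hyq : ∀ q : ℕ, q.Prime → q ∣ orderOf y → Commute (y ^ q) x := by
    intro q hq hd
    by_contra h
    have := hmin _ _ h
    have := orderOf_pow_prime_lt hq hd
    omega
  have hcx : ∀ q : ℕ, q.Prime → q ∣ orderOf x → orderOf ⁅x, y⁆ = q := by
    intro q hq hd
    have := Fact.mk hq
    refine orderOf_eq_prime ?_ hc1
    rw [← commutator_pow_left (commute_of_mem_zpowers (hl x y))]
    exact commutatorElement_eq_one_iff_commute.2 (hxq q hq hd)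
  have hcy : ∀ q : ℕ, q.Prime → q ∣ orderOf y → orderOf ⁅x, y⁆ = q := by
    intro q hq hd
    have := Fact.mk hq
    refine orderOf_eq_prime ?_ hc1
    rw [← commutatorElement_inv, inv_pow,
      ← commutator_pow_left (commute_of_mem_zpowers (hl y x)), inv_eq_one]
    exact commutatorElement_eq_one_iff_commute.2 (hyq q hq hd)
  have hx1 : orderOf x ≠ 1 := fun h =>
    hxy (by rw [orderOf_eq_one_iff.1 h]; exact Commute.one_left y)
  have hy1 : orderOf y ≠ 1 := fun h =>
    hxy (by rw [orderOf_eq_one_iff.1 h]; exact Commute.one_right x)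
  obtain ⟨p, hp, hpx⟩ := Nat.exists_prime_and_dvd hx1
  have hcp : orderOf ⁅x, y⁆ = p := hcx p hp hpx
  obtain ⟨m, hm⟩ : ∃ m, orderOf x = p ^ m := ⟨_, Nat.eq_prime_pow_of_unique_prime_dvd
    (orderOf_pos x).ne' fun {d} hd hdx => (hcx d hd hdx).symm.trans hcp⟩
  obtain ⟨n', hn'⟩ : ∃ n, orderOf y = p ^ n := ⟨_, Nat.eq_prime_pow_of_unique_prime_dvd
    (orderOf_pos y).ne' fun {d} hd hdy => (hcy d hd hdy).symm.trans hcp⟩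
  obtain ⟨n, rfl⟩ : ∃ n, n' = n + 1 :=
    Nat.exists_eq_succ_of_ne_zero (by rintro rfl; simp at hn'; exact hy1 (by simp [hn']))
  have hnm : n + 1 ≤ m := (Nat.pow_le_pow_iff_right hp.one_lt).1 (hm ▸ hn' ▸ hle)
  have hyn : orderOf (y ^ p ^ n) = p := by
    rw [orderOf_pow_of_dvd (pow_ne_zero _ hp.ne_zero) (hn' ▸ pow_dvd_pow p (Nat.le_succ n)), hn',
      pow_succ, Nat.mul_div_cancel_left _ (pow_pos hp.pos n)]
  -- The element of order `p` in `⟨y⟩` is a power of the commutator, hence of `x`.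
  have hyx : y ^ p ^ n ∈ Subgroup.zpowers x := by
    have h := mem_zpowers_of_orderOf_eq (hr x y) (pow_mem (Subgroup.mem_zpowers y) _) hcp hyn
    exact (Subgroup.zpowers_le.2 (hl x y)) h
  obtain ⟨s, hs⟩ := mem_powers_iff_mem_zpowers.2 hyx
  have hsp : p ^ (n + 1) ∣ s * p := by
    refine (pow_dvd_pow p hnm).trans (hm ▸ orderOf_dvd_of_pow_eq_one ?_)
    rw [pow_mul, show x ^ s = y ^ p ^ n from hs]
    nth_rw 2 [← hyn]
    exact pow_orderOf_eq_one _
  obtain ⟨u, rfl⟩ : p ^ n ∣ s := by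
    rw [pow_succ] at hsp
    exact Nat.dvd_of_mul_dvd_mul_right hp.pos hsp
  have hs : x ^ (p ^ n * u) = y ^ p ^ n := hs
  -- The element `w` is chosen so that `w ^ p ^ n` cancels `y ^ p ^ n`.
  obtain ⟨w, hw⟩ : ∃ w, w = (x ^ u)⁻¹ := ⟨_, rfl⟩
  have hxw : Commute x w := hw ▸ ((Commute.refl x).pow_right u).inv_right
  have hwn : w ^ p ^ n = (y ^ p ^ n)⁻¹ := by
    rw [hw, inv_pow, ← pow_mul, mul_comm u, hs]
  have hwp : Commute (w ^ p) y := by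
    rw [hw, inv_pow, pow_right_comm]
    exact ((hxq p hp hpx).pow_left u).inv_left
  have hdw : Commute w ⁅w, y⁆ := commute_of_mem_zpowers (hl w y)
  have hdy : Commute y ⁅w, y⁆ := commute_of_mem_zpowers (hr w y)
  have hdp : ⁅w, y⁆ ^ p = 1 := by
    rw [← commutator_pow_left hdw]
    exact commutatorElement_eq_one_iff_commute.2 hwp
  have hyw : ¬ Commute x (y * w) := fun h => hxy <| by
    have := h.mul_right hxw.inv_right
    rwa [mul_inv_cancel_right] at this
  have hpow : (y * w) ^ p ^ n = ⁅w, y⁆ ^ (p ^ n).choose 2 := by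
    rw [mul_pow_of_commute_commutator hdw hdy, hwn, mul_inv_cancel, one_mul]
  -- Minimality forbids `y * w` to have smaller order than `y`.
  have hdne : ⁅w, y⁆ ^ (p ^ n).choose 2 ≠ 1 := by
    rw [← hpow]
    intro h
    have h1 := hmin _ _ hyw
    have h2 : orderOf (y * w) ≤ p ^ n := orderOf_le_of_pow_eq_one (pow_pos hp.pos n) h
    have h3 : p ^ n < p ^ (n + 1) := Nat.pow_lt_pow_right hp.one_lt (Nat.lt_succ_self n)
    omega
  have hndvd : ¬ p ∣ (p ^ n).choose 2 := fun ⟨k, hk⟩ => hdne <| by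
    rw [hk, pow_mul, hdp, one_pow]
  obtain ⟨rfl, rfl⟩ := eq_two_of_not_dvd_choose_two hp hndvd
  -- Hence `w` does not commute with `y`, so it is not of smaller order than `x`.
  have hwy : ¬ Commute w y := fun h => hdne <| by
    rw [commutatorElement_eq_one_iff_commute.2 h, one_pow]
  have h4 : orderOf w ≤ 4 := by
    refine orderOf_le_of_pow_eq_one (by norm_num) ?_
    have : orderOf (w ^ 2) = 2 := by
      have : w ^ 2 = (y ^ 2)⁻¹ := by simpa using hwn
      rw [this, orderOf_inv]
      simpa using hyn
    rw [show 4 = 2 * 2 from rfl, pow_mul]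
    nth_rw 2 [← this]
    exact pow_orderOf_eq_one _
  have := hmin _ _ hwy
  exact ⟨by omega, by omega, hcp⟩

/-- The core of the classification: a finite nonabelian group all of whose subgroups are normal
contains two elements generating a quaternion group of order eight. -/
theorem exists_sq_eq_commutator (hD : ∀ H : Subgroup G, H.Normal)
    (hG : ∃ a b : G, a * b ≠ b * a) :
    ∃ x y : G, x ^ 2 = ⁅x, y⁆ ∧ y ^ 2 = ⁅x, y⁆ ∧ orderOf ⁅x, y⁆ = 2 := by
  obtain ⟨a, b, hab⟩ := hG
  obtain ⟨⟨x, y⟩, hxy, hmin⟩ := (Set.toFinite {q : G × G | ¬ Commute q.1 q.2}).exists_minimalFor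
    (fun q => orderOf q.1 + orderOf q.2) _ ⟨(a, b), hab⟩
  have hmin : ∀ a b : G, ¬ Commute a b → orderOf x + orderOf y ≤ orderOf a + orderOf b := by
    intro a b h
    by_contra hlt
    have := hmin (j := (a, b)) h
    simp only at this
    omega
  have hxy : ¬ Commute x y := hxy
  obtain ⟨hx, hy, hc⟩ : orderOf x = 4 ∧ orderOf y = 4 ∧ orderOf ⁅x, y⁆ = 2 := by
    rcases le_total (orderOf y) (orderOf x) with hle | hle
    · exact orderOf_eq_four_of_minimal hD hxy hmin hle
    · obtain ⟨h1, h2, h3⟩ := orderOf_eq_four_of_minimal hD (fun h => hxy h.symm)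
        (fun a b h => (add_comm _ _).trans_le (hmin a b h)) hle
      exact ⟨h2, h1, by rw [← commutatorElement_inv, orderOf_inv, h3]⟩
  have hc1 : ⁅x, y⁆ ≠ 1 := fun h => by simp [h] at hc
  have key : ∀ g : G, orderOf g = 4 → ⁅x, y⁆ ∈ Subgroup.zpowers g → g ^ 2 = ⁅x, y⁆ := by
    intro g hg hmem
    have h2 : orderOf (g ^ 2) = 2 := by
      rw [orderOf_pow_of_dvd two_ne_zero (by rw [hg]; norm_num), hg]
    obtain ⟨k, hk⟩ := mem_zpowers_of_orderOf_eq hmem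
      (pow_mem (Subgroup.mem_zpowers g) 2) hc h2
    have hcsq : ⁅x, y⁆ ^ 2 = 1 := hc ▸ pow_orderOf_eq_one ⁅x, y⁆
    rcases Int.even_or_odd' k with ⟨j, rfl | rfl⟩
    · have : g ^ 2 = 1 := by
        rw [← hk]
        simp only [zpow_mul]
        rw [zpow_ofNat, hcsq, one_zpow]
      simp [this] at h2
    · rw [← hk]
      simp only [zpow_add, zpow_mul]
      rw [zpow_ofNat, hcsq, one_zpow, one_mul, zpow_one]
  exact ⟨x, y, key x hx (commutator_mem_zpowers_left hD x y),
    key y hy (commutator_mem_zpowers_right hD x y), hc⟩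

end MinimalPair

/-! ### The splitting of a 2-group over a quaternion subgroup -/

section QuaternionHom

open QuaternionGroup

variable {G : Type*} [Group G]

/-- The homomorphism from the quaternion group of order eight given by two elements `x`, `y` that
satisfy its defining relations; it sends `a i` to `x ^ i` and `xa i` to `y * x ^ i`. -/
def quaternionHom (x y : G) (h4 : x ^ 4 = 1) (hxy : x * y = y * x ^ 3) (hyy : y ^ 2 = x ^ 2) :
    QuaternionGroup 2 →* G :=
  MonoidHom.mk' (fun g => match g with
    | a i => x ^ (show ZMod 4 from i).val
    | xa i => y * x ^ (show ZMod 4 from i).val) <| by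
  have hn : ∀ k : ℕ, x ^ k * y = y * x ^ (3 * k) := by
    intro k
    induction k with
    | zero => simp
    | succ k ih =>
      rw [pow_succ, mul_assoc, hxy, ← mul_assoc, ih, mul_assoc, ← pow_add, mul_add, mul_one]
  have hsub : ∀ i j : ZMod 4, (j - i).val = (3 * i.val + j.val) % 4 := by decide
  have hsub' : ∀ i j : ZMod 4, (2 + j - i).val = (2 + (3 * i.val + j.val)) % 4 := by decide
  have hadd : ∀ i j : ZMod 4, (i + j).val = (i.val + j.val) % 4 := by decide
  rintro (i | i) (j | j)
  · simp only [a_mul_a]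
    rw [← pow_add, pow_eq_pow_mod (_ + _) h4]
    exact congrArg (x ^ ·) (hadd i j)
  · simp only [a_mul_xa]
    rw [← mul_assoc, hn, mul_assoc, ← pow_add, pow_eq_pow_mod (_ + _) h4]
    exact congrArg (y * x ^ ·) (hsub i j)
  · simp only [xa_mul_a]
    rw [mul_assoc, ← pow_add, pow_eq_pow_mod (_ + _) h4]
    exact congrArg (y * x ^ ·) (hadd i j)
  · simp only [xa_mul_xa]
    rw [mul_assoc, ← mul_assoc _ y, hn, mul_assoc, ← pow_add, ← mul_assoc, ← sq y, hyy, ← pow_add,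
      pow_eq_pow_mod (_ + _) h4]
    exact congrArg (x ^ ·) (hsub' i j)

variable {x y : G} (h4 : x ^ 4 = 1) (hxy : x * y = y * x ^ 3) (hyy : y ^ 2 = x ^ 2)

theorem quaternionHom_a_one : quaternionHom x y h4 hxy hyy (a 1) = x := pow_one x

theorem quaternionHom_a_two : quaternionHom x y h4 hxy hyy (a 2) = x ^ 2 := rfl

theorem quaternionHom_xa_zero : quaternionHom x y h4 hxy hyy (xa 0) = y :=
  (congrArg (y * ·) (pow_zero x)).trans (mul_one y)

/-- A subgroup that avoids `x ^ 2` meets the quaternion subgroup trivially, since the involution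
`a 2` lies in every nontrivial subgroup of the quaternion group. -/
theorem eq_one_of_quaternionHom_mem {E : Subgroup G} (hE : x ^ 2 ∉ E) {q : QuaternionGroup 2}
    (hq : quaternionHom x y h4 hxy hyy q ∈ E) : q = 1 := by
  have : ∀ q : QuaternionGroup 2, q = 1 ∨ q = a 2 ∨ q ^ 2 = a 2 := by decide
  rcases this q with h | h | h
  · exact h
  · exact absurd (quaternionHom_a_two h4 hxy hyy ▸ h ▸ hq) hE
  · refine absurd ?_ hE
    rw [← quaternionHom_a_two h4 hxy hyy, ← h, map_pow]
    exact pow_mem hq 2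

end QuaternionHom

section Splitting

open QuaternionGroup

variable {G : Type*} [Group G]

theorem eq_of_mem_zpowers_of_pow_four {x g : G} (h4 : x ^ 4 = 1) (hg : g ∈ Subgroup.zpowers x) :
    g = 1 ∨ g = x ∨ g = x ^ 2 ∨ g = x ^ 3 := by
  have hfin := isOfFinOrder_iff_pow_eq_one.2 ⟨4, by norm_num, h4⟩
  obtain ⟨k, hk⟩ := hfin.mem_powers_iff_mem_zpowers.2 hg
  have hk : x ^ (k % 4) = g := (pow_eq_pow_mod k h4).symm.trans hk
  have := Nat.mod_lt k (by norm_num : 0 < 4)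
  interval_cases k % 4 <;> simp_all

theorem commute_or_semiconjBy_pow_three (hD : ∀ H : Subgroup G, H.Normal) {x : G}
    (h4 : x ^ 4 = 1) (h2 : x ^ 2 ≠ 1) (g : G) : Commute g x ∨ SemiconjBy g x (x ^ 3) := by
  have hg : g * x * g⁻¹ ∈ Subgroup.zpowers x := (hD _).conj_mem x (Subgroup.mem_zpowers x) g
  rcases eq_of_mem_zpowers_of_pow_four h4 hg with h | h | h | h
  · rw [conj_eq_one_iff] at h
    simp [h] at h2
  · exact Or.inl (mul_inv_eq_iff_eq_mul.1 h)
  · refine absurd ?_ h2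
    rw [← conj_eq_one_iff (a := g), ← conj_pow, h, ← pow_mul, h4]
  · exact Or.inr (mul_inv_eq_iff_eq_mul.1 h)

theorem SemiconjBy.pow_three_right {x g : G} (h4 : x ^ 4 = 1) (h : SemiconjBy g x (x ^ 3)) :
    SemiconjBy g (x ^ 3) x := by
  have := h.pow_right 3
  rwa [← pow_mul, pow_eq_pow_mod (3 * 3) h4, pow_one] at this

variable {x y : G}

/-- The inner automorphisms of a quaternion subgroup realise all the automorphisms that the whole
group induces on it by conjugation, so the quaternion subgroup and its centralizer generate. -/
theorem exists_mul_quaternionHom_commute (hD : ∀ H : Subgroup G, H.Normal) (h4 : x ^ 4 = 1)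
    (hxy : x * y = y * x ^ 3) (hyy : y ^ 2 = x ^ 2) (h2 : x ^ 2 ≠ 1) (g : G) :
    ∃ q, Commute (g * quaternionHom x y h4 hxy hyy q) x ∧
      Commute (g * quaternionHom x y h4 hxy hyy q) y := by
  have hy4 : y ^ 4 = 1 := by rw [show 4 = 2 * 2 from rfl, pow_mul, hyy, ← pow_mul, h4]
  have hy2 : y ^ 2 ≠ 1 := hyy ▸ h2
  have hyx : SemiconjBy y x (x ^ 3) := by
    have h : SemiconjBy y (x ^ 3) x := hxy.symm
    have := h.pow_right 3
    rwa [← pow_mul, pow_eq_pow_mod (3 * 3) h4, pow_one] at this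
  have hxy' : SemiconjBy x y (y ^ 3) := by
    change x * y = y ^ 3 * x
    rw [hxy, pow_succ' y, hyy, pow_succ x 2, mul_assoc]
  have hqx := quaternionHom_a_one h4 hxy hyy
  have hqy := quaternionHom_xa_zero h4 hxy hyy
  rcases commute_or_semiconjBy_pow_three hD h4 h2 g with hx | hx <;>
    rcases commute_or_semiconjBy_pow_three hD hy4 hy2 g with hy | hy
  · exact ⟨1, by simpa using hx, by simpa using hy⟩
  · refine ⟨a 1, ?_, ?_⟩ <;> rw [hqx]
    · exact hx.mul_left (Commute.refl x)
    · exact (hy.pow_three_right hy4).mul_left hxy'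
  · refine ⟨xa 0, ?_, ?_⟩ <;> rw [hqy]
    · exact (hx.pow_three_right h4).mul_left hyx
    · exact hy.mul_left (Commute.refl y)
  · refine ⟨a 1 * xa 0, ?_, ?_⟩ <;> rw [map_mul, hqx, hqy]
    · exact (hx.pow_three_right h4).mul_left
        (SemiconjBy.mul_left ((Commute.refl x).pow_right 3) hyx)
    · exact (hy.pow_three_right hy4).mul_left (hxy'.mul_left (Commute.refl y))

/-- Otherwise the subgroup generated by `c * x` would not be normalized by `y`. -/
theorem sq_eq_one_of_pow_four_of_commute (hD : ∀ H : Subgroup G, H.Normal) (h4 : x ^ 4 = 1)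
    (hxy : x * y = y * x ^ 3) (hyy : y ^ 2 = x ^ 2) (h2 : x ^ 2 ≠ 1) {c : G}
    (hcx : Commute c x) (hcy : Commute c y) (hc4 : c ^ 4 = 1) : c ^ 2 = 1 := by
  have hcomm : ⁅c * x, y⁆ = x ^ 2 := by
    have hc : Commute c (x * y * x⁻¹) := (hcx.mul_right hcy).mul_right hcx.inv_right
    calc ⁅c * x, y⁆ = c * (x * y * x⁻¹) * c⁻¹ * y⁻¹ := by
          simp [commutatorElement_def, mul_assoc]
      _ = x * y * x⁻¹ * y⁻¹ := by rw [hc.eq, mul_inv_cancel_right]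
      _ = y * x ^ 2 * y⁻¹ := by rw [hxy, pow_succ, ← mul_assoc, mul_inv_cancel_right]
      _ = x ^ 2 := by rw [← hyy, ← pow_succ', pow_succ, mul_inv_cancel_right]
  have hmem := commutator_mem_zpowers_left hD (c * x) y
  rw [hcomm] at hmem
  have hp4 : (c * x) ^ 4 = 1 := by rw [hcx.mul_pow, hc4, h4, one_mul]
  have hne : c * x ≠ x ^ 2 := by
    intro h
    rw [sq, mul_left_inj] at h
    subst h
    apply h2
    have := hcy.eq.symm.trans hxy
    rwa [mul_right_inj, pow_succ', left_eq_mul] at this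
  -- The commutator `x ^ 2` of `c * x` and `y` is a power of `c * x`.
  rcases eq_of_mem_zpowers_of_pow_four hp4 hmem with h | h | h | h
  · exact absurd h h2
  · exact absurd h.symm hne
  · rwa [hcx.mul_pow, right_eq_mul] at h
  · refine absurd ?_ hne
    have := congrArg (· ^ 3) h
    simp only [← pow_mul] at this
    rw [pow_eq_pow_mod (2 * 3) h4, pow_eq_pow_mod (3 * 3) hp4] at this
    simpa using this.symm

theorem sq_eq_one_of_commute (hD : ∀ H : Subgroup G, H.Normal) (hG : IsPGroup 2 G)
    (h4 : x ^ 4 = 1) (hxy : x * y = y * x ^ 3) (hyy : y ^ 2 = x ^ 2) (h2 : x ^ 2 ≠ 1) {c : G}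
    (hcx : Commute c x) (hcy : Commute c y) : c ^ 2 = 1 := by
  obtain ⟨k, hk⟩ := hG c
  induction k with
  | zero => simp_all
  | succ k ih =>
    cases k with
    | zero => simpa using hk
    | succ k =>
      refine ih ?_
      rw [pow_succ 2 k, pow_mul]
      refine sq_eq_one_of_pow_four_of_commute hD h4 hxy hyy h2 (hcx.pow_left _) (hcy.pow_left _) ?_
      rw [← pow_mul, ← hk]
      ring_nf

/-- A subgroup `E` that is maximal for avoiding the central involution of a quaternion subgroup
is a direct complement of that quaternion subgroup. -/
theorem exists_quaternion_prod_mulEquiv [Finite G] (hD : ∀ H : Subgroup G, H.Normal)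
    (hG : IsPGroup 2 G) (h4 : x ^ 4 = 1) (hxy : x * y = y * x ^ 3) (hyy : y ^ 2 = x ^ 2)
    (h2 : x ^ 2 ≠ 1) :
    ∃ E : Subgroup G, (∀ c ∈ E, c ^ 2 = 1) ∧ Nonempty (QuaternionGroup 2 × E ≃* G) := by
  obtain ⟨E, hE⟩ := (Set.toFinite {E : Subgroup G | x ^ 2 ∉ E}).exists_maximal
    ⟨⊥, by simpa using h2⟩
  have hzE : x ^ 2 ∉ E := hE.prop
  have hnE := hD E
  let φ := quaternionHom x y h4 hxy hyy
  have hcomm : ∀ g : QuaternionGroup 2, ∀ c ∈ E, Commute (φ g) c := by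
    have hdis : Disjoint φ.range E := by
      rw [Subgroup.disjoint_def]
      rintro _ ⟨q, rfl⟩ hq
      rw [eq_one_of_quaternionHom_mem h4 hxy hyy hzE hq, map_one]
    intro g c hc
    exact Subgroup.commute_of_normal_of_disjoint _ _ (hD _) hnE hdis _ _ ⟨g, rfl⟩ hc
  have hsq : ∀ c : G, Commute c x → Commute c y → c ^ 2 = 1 := fun c hcx hcy =>
    sq_eq_one_of_commute hD hG h4 hxy hyy h2 hcx hcy
  have hEsq : ∀ c ∈ E, c ^ 2 = 1 := by
    intro c hc
    refine hsq c ?_ ?_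
    · have := (hcomm (a 1) c hc).symm
      rwa [show φ (a 1) = x from quaternionHom_a_one h4 hxy hyy] at this
    · have := (hcomm (xa 0) c hc).symm
      rwa [show φ (xa 0) = y from quaternionHom_xa_zero h4 hxy hyy] at this
  have hφE : ∀ (q : QuaternionGroup 2) (c : E), Commute (φ q) (E.subtype c) :=
    fun q c => hcomm q c c.2
  refine ⟨E, hEsq, ⟨MulEquiv.ofBijective (φ.noncommCoprod E.subtype hφE) ⟨?_, ?_⟩⟩⟩
  · rw [MonoidHom.noncommCoprod_injective]
    refine ⟨(injective_iff_map_eq_one φ).2 fun q hq => ?_, E.subtype_injective, ?_⟩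
    · exact eq_one_of_quaternionHom_mem h4 hxy hyy hzE (hq ▸ one_mem E : φ q ∈ E)
    · rw [Subgroup.disjoint_def, Subgroup.range_subtype]
      rintro _ ⟨q, rfl⟩ hq
      rw [eq_one_of_quaternionHom_mem h4 hxy hyy hzE hq, map_one]
  · rw [← MonoidHom.range_eq_top, MonoidHom.noncommCoprod_range, Subgroup.range_subtype, eq_top_iff]
    intro g _
    obtain ⟨q, hqx, hqy⟩ := exists_mul_quaternionHom_commute hD h4 hxy hyy h2 g
    have hz : x ^ 2 ∈ φ.range := ⟨a 2, quaternionHom_a_two h4 hxy hyy⟩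
    suffices h : g * φ q ∈ φ.range ⊔ E by
      have := mul_mem h (inv_mem ((le_sup_left : φ.range ≤ φ.range ⊔ E) ⟨q, rfl⟩))
      rwa [mul_inv_cancel_right] at this
    set c := g * φ q with hc
    by_cases hcE : c ∈ E
    · exact (le_sup_right : E ≤ φ.range ⊔ E) hcE
    -- By maximality the subgroup generated by `E` and `c` contains `x ^ 2`.
    have hmem : x ^ 2 ∈ E ⊔ Subgroup.zpowers c := by
      by_contra hn
      exact hcE (hE.le_of_ge hn le_sup_left
        ((le_sup_right : Subgroup.zpowers c ≤ _) (Subgroup.mem_zpowers c)))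
    obtain ⟨e, he, d, hd, hed⟩ := Subgroup.mem_sup_of_normal_left.1 hmem
    have hc2 : c ^ 2 = 1 := hsq c hqx hqy
    have hd' : d = 1 ∨ d = c := by
      have hc4 : c ^ 4 = 1 := by rw [show 4 = 2 * 2 from rfl, pow_mul, hc2, one_pow]
      have hc3 : c ^ 3 = c := by rw [pow_succ, hc2, one_mul]
      have := eq_of_mem_zpowers_of_pow_four hc4 hd
      rw [hc2, hc3] at this
      tauto
    rcases hd' with rfl | rfl
    · rw [mul_one] at hed
      exact absurd (hed ▸ he) hzE
    · have hce : c = e⁻¹ * x ^ 2 := by rw [← hed, inv_mul_cancel_left]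
      rw [hce]
      exact mul_mem ((le_sup_right : E ≤ φ.range ⊔ E) (inv_mem he))
        ((le_sup_left : φ.range ≤ φ.range ⊔ E) hz)

end Splitting

/-! ### The structure of finite hamiltonian groups -/

section Structure

open QuaternionGroup

theorem Subgroup.forall_normal_of_forall_normal {G : Type*} [Group G]
    (hD : ∀ H : Subgroup G, H.Normal) (T : Subgroup G) (H : Subgroup T) : H.Normal := by
  have h := hD (H.map T.subtype)
  have := h.comap T.subtype
  rwa [Subgroup.comap_map_eq_self_of_injective T.subtype_injective] at this

theorem isAbelianGroup_of_odd_card {G : Type*} [Group G] (hodd : Odd (Nat.card G))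
    (hD : ∀ H : Subgroup G, H.Normal) : IsAbelianGroup G := by
  have : Finite G := Nat.finite_of_card_ne_zero hodd.pos.ne'
  by_contra h
  obtain ⟨x, y, -, -, hc⟩ := exists_sq_eq_commutator hD (by simpa [IsAbelianGroup] using h)
  exact Nat.not_even_iff_odd.2 hodd (even_iff_two_dvd.2 (hc ▸ orderOf_dvd_natCard _))

/-- A group of exponent two is a vector space over the field with two elements. -/
theorem nonempty_mulEquiv_of_sq_eq_one {E : Type*} [Group E] {k : ℕ} (hcard : Nat.card E = 2 ^ k)
    (hsq : ∀ c : E, c ^ 2 = 1) : Nonempty (E ≃* Multiplicative (Fin k → ZMod 2)) := by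
  have : Finite E := Nat.finite_of_card_ne_zero (by rw [hcard]; positivity)
  let _ : CommGroup E :=
    { mul_comm := fun a b => by
        have h := hsq (a * b)
        have hinv : ∀ c : E, c⁻¹ = c := fun c => inv_eq_of_mul_eq_one_left (by rw [← sq, hsq])
        rw [← hinv (a * b), mul_inv_rev, hinv, hinv] }
  let _ : Module (ZMod 2) (Additive E) := AddCommGroup.zmodModule fun x => hsq x.toMul
  have : Fintype E := Fintype.ofFinite E
  have hfin : Module.finrank (ZMod 2) (Additive E) = k := by
    have h := Module.card_eq_pow_finrank (K := ZMod 2) (V := Additive E)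
    rw [ZMod.card, ← Nat.card_eq_fintype_card] at h
    exact (Nat.pow_right_injective le_rfl (hcard.symm.trans h)).symm
  let f := LinearEquiv.ofFinrankEq (R := ZMod 2) (Additive E) (Fin k → ZMod 2) (by simpa using hfin)
  exact ⟨AddEquiv.toMultiplicativeRight f.toAddEquiv⟩

theorem IsHamiltonianGroup.exists_quaternion_prod_mulEquiv_of_isPGroup {T : Type*} [Group T]
    {e : ℕ} (hcard : Nat.card T = 2 ^ e) (hT : IsHamiltonianGroup T) : 3 ≤ e ∧
    Nonempty (QuaternionGroup 2 × Multiplicative (Fin (e - 3) → ZMod 2) ≃* T) := by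
  have : Finite T := Nat.finite_of_card_ne_zero (by rw [hcard]; positivity)
  obtain ⟨hne, hD⟩ := hT
  obtain ⟨x, y, hx, hy, hc⟩ := exists_sq_eq_commutator hD hne
  have h2 : x ^ 2 ≠ 1 := by
    intro h
    rw [← hx, h] at hc
    simp at hc
  have h4 : x ^ 4 = 1 := by
    rw [show 4 = 2 * 2 from rfl, pow_mul, hx, ← hc, pow_orderOf_eq_one]
  have hxy : x * y = y * x ^ 3 := by
    have h1 : ⁅x, y⁆ * y * x = x * y := by simp [commutatorElement_def]
    rw [← h1, ← hy, ← pow_succ, pow_succ', hy, ← hx, mul_assoc, ← pow_succ]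
  obtain ⟨E, hE, ⟨f⟩⟩ := exists_quaternion_prod_mulEquiv hD (IsPGroup.of_card hcard) h4 hxy
    (hy.trans hx.symm) h2
  have hEc : 2 ^ 3 * Nat.card E = 2 ^ e := by
    rw [← hcard, ← Nat.card_congr f.toEquiv, Nat.card_prod,
      Nat.card_eq_fintype_card (α := QuaternionGroup 2), QuaternionGroup.card,
      show 2 ^ 3 = 4 * 2 from rfl]
  have he : 3 ≤ e := (Nat.pow_dvd_pow_iff_le_right (by norm_num)).1 (Dvd.intro _ hEc)
  refine ⟨he, ?_⟩
  have hEk : Nat.card E = 2 ^ (e - 3) := by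
    rw [← Nat.mul_right_inj (show 2 ^ 3 ≠ 0 by norm_num), hEc, ← pow_add, Nat.add_sub_cancel' he]
  obtain ⟨g⟩ := nonempty_mulEquiv_of_sq_eq_one hEk fun c => Subtype.ext (by simpa using hE c c.2)
  exact ⟨((MulEquiv.refl _).prodCongr g.symm).trans f⟩

/-- The classification of finite hamiltonian groups, due to Dedekind: such a group is the direct
product of the quaternion group of order eight, an elementary abelian 2-group and an abelian group
of odd order. -/
theorem IsHamiltonianGroup.exists_mulEquiv {G : Type*} [Group G] {e o : ℕ} (ho : Odd o)
    (hcard : Nat.card G = 2 ^ e * o) (hG : IsHamiltonianGroup G) :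
    3 ≤ e ∧ ∃ A : Subgroup G, Nat.card A = o ∧ IsAbelianGroup A ∧
      Nonempty ((QuaternionGroup 2 × Multiplicative (Fin (e - 3) → ZMod 2)) × A ≃* G) := by
  have : Finite G := Nat.finite_of_card_ne_zero (by rw [hcard]; have := ho.pos; positivity)
  obtain ⟨⟨a, b, hab⟩, hD⟩ := hG
  obtain ⟨P⟩ : Nonempty (Sylow 2 G) := inferInstance
  have hPn : (P : Subgroup G).Normal := hD _
  obtain ⟨A, hA⟩ := Subgroup.exists_right_complement'_of_coprime P.card_coprime_index
  have hP : Nat.card P = 2 ^ e := by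
    rw [P.card_eq_multiplicity, hcard, Nat.factorization_mul (by positivity) ho.pos.ne']
    simp [Nat.prime_two.factorization_pow,
      Nat.factorization_eq_zero_of_not_dvd ho.not_two_dvd_nat]
  have hAo : Nat.card A = o := by
    have := hA.card_mul_card
    rw [hP, hcard] at this
    exact Nat.eq_of_mul_eq_mul_left (by positivity) this
  have hAab : IsAbelianGroup A := isAbelianGroup_of_odd_card (hAo ▸ ho)
    (Subgroup.forall_normal_of_forall_normal hD A)
  have hPA : ∀ (p : (P : Subgroup G)) (q : A),
      Commute ((P : Subgroup G).subtype p) (A.subtype q) := fun p q =>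
    Subgroup.commute_of_normal_of_disjoint _ _ hPn (hD A) hA.disjoint _ _ p.2 q.2
  let f : ↥(P : Subgroup G) × A ≃* G :=
    MulEquiv.ofBijective ((P : Subgroup G).subtype.noncommCoprod A.subtype hPA) hA
  have hPham : IsHamiltonianGroup (P : Subgroup G) := by
    refine ⟨?_, Subgroup.forall_normal_of_forall_normal hD _⟩
    by_contra! h
    apply hab
    apply f.symm.injective
    rw [map_mul, map_mul]
    exact Prod.ext (h _ _) (hAab _ _)
  obtain ⟨he, ⟨g⟩⟩ := hPham.exists_quaternion_prod_mulEquiv_of_isPGroup hP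
  exact ⟨he, A, hAo, hAab, ⟨(g.prodCongr (MulEquiv.refl A)).trans f⟩⟩

/-- A product of this form is nonabelian, and each conjugate of an element is a power of it. -/
theorem isHamiltonianGroup_quaternion_prod {A : Type*} [Group A] {k : ℕ}
    (hodd : Odd (Nat.card A)) (hA : IsAbelianGroup A) :
    IsHamiltonianGroup ((QuaternionGroup 2 × Multiplicative (Fin k → ZMod 2)) × A) := by
  refine ⟨⟨((a 1, 1), 1), ((xa 0, 1), 1), ?_⟩, fun H => ⟨?_⟩⟩
  · intro h
    have h := congrArg (fun g => g.1.1) h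
    exact absurd h (by decide : (a 1 : QuaternionGroup 2) * xa 0 ≠ xa 0 * a 1)
  rintro ⟨⟨q, v⟩, b⟩ hg ⟨⟨r, w⟩, c⟩
  have hconj : ∀ q r : QuaternionGroup 2, r * q * r⁻¹ = q ∨ r * q * r⁻¹ = q ^ 3 := by decide
  have hw : w * v * w⁻¹ = v := by rw [mul_comm w, mul_inv_cancel_right]
  have hc : c * b * c⁻¹ = b := by rw [hA c, mul_inv_cancel_right]
  rw [show (((r, w), c) : (QuaternionGroup 2 × Multiplicative (Fin k → ZMod 2)) × A) *
    ((q, v), b) * ((r, w), c)⁻¹ = ((r * q * r⁻¹, w * v * w⁻¹), c * b * c⁻¹) from rfl, hw, hc]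
  rcases hconj q r with h | h
  · rwa [h]
  -- A power that cubes the quaternion component and fixes the other two.
  have hcop : Nat.Coprime 4 (Nat.card A) := Nat.Coprime.pow_left 2 hodd.coprime_two_left
  obtain ⟨m, hm4, hmA⟩ := Nat.chineseRemainder hcop 3 1
  have hq4 : q ^ 4 = 1 := (by decide : ∀ q : QuaternionGroup 2, q ^ 4 = 1) q
  have hq : q ^ m = q ^ 3 := by rw [pow_eq_pow_mod m hq4, hm4]
  have hb : b ^ m = b := by
    conv_rhs => rw [← pow_one b]
    rw [pow_eq_pow_iff_modEq]
    exact hmA.of_dvd (orderOf_dvd_natCard b)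
  have hv2 : v ^ 2 = 1 := by
    apply Multiplicative.toAdd.injective
    ext i
    simp [CharTwo.two_eq_zero]
  have hv : v ^ m = v := by
    have : m % 2 = 1 := by
      have : m % 4 = 3 := hm4
      omega
    rw [pow_eq_pow_mod m hv2, this, pow_one]
  have := pow_mem hg m
  rwa [show (((q, v), b) : (QuaternionGroup 2 × Multiplicative (Fin k → ZMod 2)) × A) ^ m =
    ((q ^ m, v ^ m), b ^ m) from rfl, hq, hv, hb, ← h] at this

/-- The odd factor is determined by the product, since the other factor has exponent four. -/
theorem nonempty_mulEquiv_of_quaternion_prod {A B : Type*} [Group A] [Group B] {k : ℕ}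
    (hodd : Odd (Nat.card A)) (hcard : Nat.card A = Nat.card B)
    (f : (QuaternionGroup 2 × Multiplicative (Fin k → ZMod 2)) × A ≃*
      (QuaternionGroup 2 × Multiplicative (Fin k → ZMod 2)) × B) : Nonempty (A ≃* B) := by
  have : Finite A := Nat.finite_of_card_ne_zero hodd.pos.ne'
  have : Finite B := Nat.finite_of_card_ne_zero (hcard ▸ hodd.pos.ne')
  let g : A →* B := (MonoidHom.snd _ B).comp (f.toMonoidHom.comp (MonoidHom.inr _ A))
  have hg : Function.Injective g := by
    rw [injective_iff_map_eq_one]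
    intro a ha
    have hq4 : ∀ q : QuaternionGroup 2, q ^ 4 = 1 := by decide
    have hv4 : ∀ v : Multiplicative (Fin k → ZMod 2), v ^ 4 = 1 := by
      intro v
      apply Multiplicative.toAdd.injective
      ext i
      simp [show (4 : ZMod 2) = 0 from rfl]
    have h4 : f (1, a) ^ 4 = 1 :=
      Prod.ext (Prod.ext (hq4 _) (hv4 _)) (by
        change g a ^ 4 = 1
        rw [ha, one_pow])
    have ha4 : a ^ 4 = 1 := by
      rw [← map_pow, ← map_one f] at h4
      exact congrArg Prod.snd (f.injective h4)
    have hcop : Nat.Coprime 4 (Nat.card A) := Nat.Coprime.pow_left 2 hodd.coprime_two_left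
    rw [← orderOf_eq_one_iff]
    exact Nat.eq_one_of_dvd_coprimes hcop (orderOf_dvd_of_pow_eq_one ha4) (orderOf_dvd_natCard a)
  exact ⟨MulEquiv.ofBijective g ((Nat.bijective_iff_injective_and_card g).2 ⟨hg, hcard⟩)⟩

end Structure

/-! ### Counting isomorphism classes -/

section Counting

variable {P Q : (G : Type) → [Group G] → Prop} {m n : ℕ}

/-- The set `Fin n` as a type synonym that carries the group structure `s` and no other
multiplication. -/
def GroupStr.Carrier (_ : GroupStr P n) : Type := Fin n

instance GroupStr.instGroupCarrier (s : GroupStr P n) : Group s.Carrier := s.1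

theorem GroupStr.card_carrier (s : GroupStr P n) : Nat.card s.Carrier = n := Nat.card_fin n

theorem GroupStr.prop_carrier (s : GroupStr P n) : P s.Carrier := s.2

theorem exists_group_mulEquiv {X G : Type} [Group G] (f : X ≃ G) :
    ∃ _ : Group X, Nonempty (G ≃* X) :=
  ⟨f.group, ⟨letI := f.group; f.mulEquiv.symm⟩⟩

theorem GroupStr.exists_mulEquiv_carrier
    (hP : ∀ {G H : Type} [Group G] [Group H], G ≃* H → P G → P H) {G : Type} [Group G]
    (hn : n ≠ 0) (hcard : Nat.card G = n) (hG : P G) :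
    ∃ s : GroupStr P n, Nonempty (G ≃* s.Carrier) := by
  have : Finite G := Nat.finite_of_card_ne_zero (hcard ▸ hn)
  obtain ⟨s, ⟨f⟩⟩ := exists_group_mulEquiv (Finite.equivFinOfCardEq hcard).symm
  exact ⟨⟨s, @hP G (Fin n) _ s f hG⟩, ⟨f⟩⟩

theorem GroupStr.quotient_mk_eq {s t : GroupStr P n} (h : Nonempty (s.Carrier ≃* t.Carrier)) :
    Quotient.mk (GroupStr.isoSetoid P n) s = Quotient.mk (GroupStr.isoSetoid P n) t :=
  Quotient.sound (s := GroupStr.isoSetoid P n) h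

/-- Two counts of isomorphism classes agree when a construction `F` turns groups of the first kind
into groups of the second kind, reaches all of them up to isomorphism, and both preserves and
reflects isomorphism. -/
theorem numGroups_eq_of_construction
    (hQ : ∀ {G H : Type} [Group G] [Group H], G ≃* H → Q G → Q H) (hn : n ≠ 0)
    (F : (G : Type) → [Group G] → Type) (grp : ∀ (G : Type) [Group G], Group (F G))
    (hcard : ∀ (G : Type) [Group G], Nat.card G = m → Nat.card (F G) = n)
    (hprop : ∀ (G : Type) [Group G], Nat.card G = m → P G → Q (F G))
    (hmap : ∀ (G H : Type) [Group G] [Group H], Nonempty (G ≃* H) → Nonempty (F G ≃* F H))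
    (hinj : ∀ (G H : Type) [Group G] [Group H], Nat.card G = m → Nat.card H = m →
      Nonempty (F G ≃* F H) → Nonempty (G ≃* H))
    (hsurj : ∀ (K : Type) [Group K], Nat.card K = n → Q K →
      ∃ s : GroupStr P m, Nonempty (F s.Carrier ≃* K)) :
    numGroups P m = numGroups Q n := by
  have h : ∀ s : GroupStr P m, ∃ t : GroupStr Q n, Nonempty (F s.Carrier ≃* t.Carrier) :=
    fun s => GroupStr.exists_mulEquiv_carrier hQ hn (hcard _ s.card_carrier)
      (hprop _ s.card_carrier s.prop_carrier)
  choose f hf using h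
  have hiff : ∀ s s' : GroupStr P m, Nonempty (s.Carrier ≃* s'.Carrier) ↔
      Nonempty ((f s).Carrier ≃* (f s').Carrier) := by
    intro s s'
    obtain ⟨i⟩ := hf s
    obtain ⟨j⟩ := hf s'
    constructor
    · intro h
      obtain ⟨k⟩ := hmap _ _ h
      exact ⟨i.symm.trans (k.trans j)⟩
    · rintro ⟨k⟩
      exact hinj _ _ s.card_carrier s'.card_carrier ⟨i.trans (k.trans j.symm)⟩
  refine Nat.card_eq_of_bijective
    (Quotient.map (sa := GroupStr.isoSetoid P m) (sb := GroupStr.isoSetoid Q n) f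
      fun s s' h => (hiff s s').1 h) ⟨?_, ?_⟩
  · rintro ⟨s⟩ ⟨s'⟩ h
    exact GroupStr.quotient_mk_eq ((hiff s s').2 (Quotient.exact h))
  · rintro ⟨t⟩
    obtain ⟨s, ⟨k⟩⟩ := hsurj t.Carrier t.card_carrier t.prop_carrier
    obtain ⟨i⟩ := hf s
    exact ⟨Quotient.mk _ s, GroupStr.quotient_mk_eq ⟨i.symm.trans k⟩⟩

theorem IsAbelianGroup.of_mulEquiv {G H : Type*} [Group G] [Group H] (f : G ≃* H)
    (hG : IsAbelianGroup G) : IsAbelianGroup H := fun a b =>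
  f.symm.injective (by rw [map_mul, map_mul, hG])

theorem IsHamiltonianGroup.of_mulEquiv {G H : Type*} [Group G] [Group H] (f : G ≃* H)
    (hG : IsHamiltonianGroup G) : IsHamiltonianGroup H := by
  obtain ⟨⟨a, b, hab⟩, hD⟩ := hG
  refine ⟨⟨f a, f b, fun h => hab (f.injective (by rw [map_mul, map_mul, h]))⟩, fun K => ?_⟩
  rw [← Subgroup.map_comap_eq_self_of_surjective (f := f.toMonoidHom) f.surjective K]
  exact (hD _).map f.toMonoidHom f.surjective

end Counting

theorem proposition2 (n e o : ℕ) (ho : Odd o) (hn : n = 2 ^ e * o) :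
    numHamiltonianGroups n = if e < 3 then 0 else numAbelianGroups o := by
  have hn0 : n ≠ 0 := by
    rw [hn]
    have := ho.pos
    positivity
  split_ifs with he
  · have : IsEmpty (GroupStr (fun G [Group G] => IsHamiltonianGroup G) n) :=
      ⟨fun s => absurd (IsHamiltonianGroup.exists_mulEquiv ho (s.card_carrier.trans hn)
        s.prop_carrier).1 (by omega)⟩
    have : IsEmpty (Quotient (GroupStr.isoSetoid (fun G [Group G] => IsHamiltonianGroup G) n)) :=
      ⟨fun q => q.exists_rep.elim fun s _ => this.false s⟩
    exact Nat.card_of_isEmpty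
  · symm
    refine numGroups_eq_of_construction IsHamiltonianGroup.of_mulEquiv hn0
      (fun A _ => (QuaternionGroup 2 × Multiplicative (Fin (e - 3) → ZMod 2)) × A)
      (fun _ _ => inferInstance) ?_ ?_ ?_ ?_ ?_
    · intro A _ hA
      have : Nat.card (Multiplicative (Fin (e - 3) → ZMod 2)) = 2 ^ (e - 3) := by
        rw [Nat.card_congr Multiplicative.toAdd]
        simp
      rw [Nat.card_prod, Nat.card_prod, this, hA, hn,
        Nat.card_eq_fintype_card (α := QuaternionGroup 2), QuaternionGroup.card,
        show 4 * 2 = 2 ^ 3 from rfl, ← pow_add, Nat.add_sub_cancel' (not_lt.1 he)]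
    · intro A _ hA hab
      exact isHamiltonianGroup_quaternion_prod (hA ▸ ho) hab
    · rintro A B _ _ ⟨f⟩
      exact ⟨(MulEquiv.refl _).prodCongr f⟩
    · rintro A B _ _ hA hB ⟨f⟩
      exact nonempty_mulEquiv_of_quaternion_prod (hA ▸ ho) (hA.trans hB.symm) f
    · intro K _ hK hham
      obtain ⟨-, A, hA, hab, ⟨f⟩⟩ := IsHamiltonianGroup.exists_mulEquiv ho (hK.trans hn) hham
      obtain ⟨s, ⟨g⟩⟩ := GroupStr.exists_mulEquiv_carrier
        (P := fun G [Group G] => IsAbelianGroup G) IsAbelianGroup.of_mulEquiv ho.pos.ne' hA hab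
      exact ⟨s, ⟨((MulEquiv.refl _).prodCongr g.symm).trans f⟩⟩
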